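/- **Lindström's Lemma.** A *planar network of order $n$* is a finite acyclic directed graph $G$ (parallel edges allowed) with $2n$ distinguished vertices, the sources $s_1,\dots,s_n$ (which no edge enters) and the sinks $t_1,\dots,t_n$ (which no edge leaves), drawn in the plane with vertices as distinct points and edges as simple arcs that contain no vertices other than their two ends and meet one another only at vertices. The drawing lies in a vertical strip $\{a\le x\le b\}$, $a<b$; the sources lie on the line $x=a$ in the order $s_1,\dots,s_n$ from top to bottom, and the sinks lie on the line $x=b$ in the order $t_1,\dots,t_n$ from top to bottom (so the counterclockwise order around the boundary is $s_1,\dots,s_n,t_n,\dots,t_1$). The edges need not be monotone in any direction. The *path matrix* of $G$ is the $n\times n$ matrix $A=[a_{ij}]$, where $a_{ij}$ is the number of directed paths from $s_i$ to $t_j$. For $I,J\subseteq\{1,\dots,n\}$ with $|I|=|J|$, let $\Delta_{I,J}$ be the determinant of the submatrix of $A$ with rows $I$ and columns $J$, in increasing order. A matrix is *totally nonnegative* if all its minors are $\ge 0$. **Theorem.** Let $G$ be a planar network of order $n$ with path matrix $A$. Then all entries of $A$ are finite and $A$ is totally nonnegative. Moreover, for all $I,J\subseteq\{1,\dots,n\}$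 with $|I|=|J|$, the minor $\Delta_{I,J}$ equals the (finite) number of families of $|I|$ pairwise vertex-disjoint directed paths from the sources $\{s_i\}_{i\in I}$ to the sinks $\{t_j\}_{j\in J}$, where a family consists of one path from each source $s_i$, $i\in I$, with the endpoints making up $\{t_j\}_{j\in J}$. In every such family the path from the source with the $k$-th smallest index in $I$ ends at the sink with the $k$-th smallest index in $J$. -/

import Mathlib

/-- The minor `Δ_{I,J}` of a square matrix: the determinant of the submatrix with rows in `I` and
columns in `J`, both listed in increasing order. It is defined for `|I| = |J|`. -/
def Matrix.minorDet {n : ℕ} {R : Type*} [CommRing R] (A : Matrix (Fin n) (Fin n) R)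
    (I J : Finset (Fin n)) (h : I.card = J.card) : R :=
  (A.submatrix (I.orderEmbOfFin h) (J.orderEmbOfFin rfl)).det

/-- A real square matrix is totally nonnegative if all its minors are nonnegative. -/
def Matrix.IsTotallyNonnegative {n : ℕ} (A : Matrix (Fin n) (Fin n) ℝ) : Prop :=
  ∀ (I J : Finset (Fin n)) (h : I.card = J.card), 0 ≤ A.minorDet I J h

/-- A drawing in the plane, without crossings, of a directed (multi)graph. Vertices are distinct
points, every edge is a simple arc from its tail to its head, no arc passes through a vertex other
than its two ends, and two distinct arcs meet only at (points that represent) vertices. -/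
structure PlaneDrawing (V : Type*) [Quiver V] where
  /-- the point that represents a vertex -/
  pos : V → ℝ × ℝ
  pos_injective : Function.Injective pos
  /-- the arc that represents an edge -/
  arc : ∀ e : Quiver.Total V, _root_.Path (pos e.left) (pos e.right)
  arc_injective : ∀ e, Function.Injective (arc e)
  arc_vertex : ∀ e u w, arc e u = pos w → w = e.left ∨ w = e.right
  arc_inter : ∀ e e' u u', e ≠ e' → arc e u = arc e' u' → ∃ w, arc e u = pos w

/-- A planar network of order `n` on the (finite, acyclic, directed) graph `V`. It is drawn in the
plane without crossings, with the `n` sources at the left end of the drawing and the `n` sinks at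
its right end, and with indices increasing from top to bottom on both sides; so
`s₁, …, sₙ, tₙ, …, t₁` is their counterclockwise order around the drawing. The arcs need not be
monotone in any direction. -/
structure PlanarNetwork (V : Type*) [Quiver V] (n : ℕ) where
  finite_vertices : Finite V
  finite_edges : ∀ a b : V, Finite (a ⟶ b)
  acyclic : ∀ (v : V) (p : Quiver.Path v v), p = Quiver.Path.nil
  /-- the sources `s₁, …, sₙ` -/
  source : Fin n → V
  /-- the sinks `t₁, …, tₙ` -/
  sink : Fin n → V
  source_no_in : ∀ i (a : V), IsEmpty (a ⟶ source i)
  sink_no_out : ∀ j (b : V), IsEmpty (sink j ⟶ b)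
  drawing : PlaneDrawing V
  /-- the abscissa of the left end of the drawing -/
  xleft : ℝ
  /-- the abscissa of the right end of the drawing -/
  xright : ℝ
  xleft_lt_xright : xleft < xright
  pos_mem_strip : ∀ v, (drawing.pos v).1 ∈ Set.Icc xleft xright
  arc_mem_strip : ∀ e u, (drawing.arc e u).1 ∈ Set.Icc xleft xright
  source_left : ∀ i, (drawing.pos (source i)).1 = xleft
  sink_right : ∀ j, (drawing.pos (sink j)).1 = xright
  source_top_to_bottom : StrictAnti fun i => (drawing.pos (source i)).2
  sink_top_to_bottom : StrictAnti fun j => (drawing.pos (sink j)).2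

namespace PlanarNetwork

variable {V : Type*} [Quiver V] {n : ℕ}

/-- The path matrix: the entry `(i, j)` is the number of directed paths from `sᵢ` to `tⱼ`. -/
noncomputable def pathMatrix (G : PlanarNetwork V n) : Matrix (Fin n) (Fin n) ℝ :=
  Matrix.of fun i j => (Nat.card (Quiver.Path (G.source i) (G.sink j)) : ℝ)

/-- A family of pairwise vertex-disjoint paths from the sources in `I` to the sinks in `J`: one
path from each source in `I`, ending at pairwise different sinks that make up `J`. -/
structure DisjointFamily (G : PlanarNetwork V n) (I J : Finset (Fin n)) where
  /-- which sink each source is joined to -/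
  matching : I ≃ J
  path : ∀ i : I, Quiver.Path (G.source i) (G.sink (matching i))
  disjoint : ∀ i i' : I, i ≠ i' → List.Disjoint (path i).vertices (path i').vertices

end PlanarNetwork

/-! Expand a minor as a signed count of path families. Exchanging the tails of two paths at a common
vertex flips the sign, so families that are not disjoint cancel (`exists_sign_reversing_involution`)
and only disjoint ones count. Planarity makes every remaining sign `+1`: two disjoint paths that
reverse the order of their ends would give two curves across the strip that must meet
(`exists_eq_of_continuous_of_mem_strip`), and in a plane drawing they can meet only if the paths
share a vertex. The crossing lemma compares the turning of the difference of the two curves along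
two sides of a square. -/

/-! ### Crossing curves in a strip -/

/-- By the intermediate value theorem `ψ` cannot enter `(0, π)` or `(-2π, -π)`, so `ψ 1` lies in
`[-π, 0]`. -/
theorem Real.eq_neg_pi_of_continuous_of_sin_nonpos {ψ : ℝ → ℝ} (hψ : Continuous ψ) (h0 : ψ 0 = 0)
    (hsin : ∀ t, Real.sin (ψ t) ≤ 0) (h1 : Real.cos (ψ 1) = -1) : ψ 1 = -Real.pi := by
  have hπ := Real.pi_pos
  have hle : ψ 1 ≤ 0 := by
    by_contra! h
    obtain ⟨t, ht⟩ : min (ψ 1) (Real.pi / 2) ∈ Set.range ψ :=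
      mem_range_of_exists_le_of_exists_ge hψ ⟨0, by rw [h0]; positivity⟩ ⟨1, min_le_left _ _⟩
    have hpos : 0 < Real.sin (ψ t) := by
      rw [ht]
      exact Real.sin_pos_of_pos_of_lt_pi (by positivity) ((min_le_right _ _).trans_lt (by linarith))
    exact absurd (hsin t) hpos.not_ge
  have hge : -Real.pi ≤ ψ 1 := by
    by_contra! h
    obtain ⟨t, ht⟩ : max (ψ 1) (-(3 * Real.pi / 2)) ∈ Set.range ψ :=
      mem_range_of_exists_le_of_exists_ge hψ ⟨1, le_max_left _ _⟩
        ⟨0, by rw [h0]; exact max_le hle (by linarith)⟩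
    have hlt : ψ t < -Real.pi := by rw [ht]; exact max_lt h (by linarith)
    have hgt : -(3 * Real.pi / 2) ≤ ψ t := by rw [ht]; exact le_max_right _ _
    have hpos : 0 < Real.sin (ψ t + 2 * Real.pi) :=
      Real.sin_pos_of_pos_of_lt_pi (by linarith) (by linarith)
    rw [Real.sin_add_two_pi] at hpos
    exact absurd (hsin t) hpos.not_ge
  have h2 : Real.cos (ψ 1 + Real.pi) = 1 := by rw [Real.cos_add_pi, h1, neg_neg]
  have := (Real.cos_eq_one_iff_of_lt_of_lt (by linarith) (by linarith)).1 h2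
  linarith

theorem Complex.exists_continuous_exp_eq {F : ℝ × ℝ → ℂ} (hF : Continuous F) (h0 : ∀ x, F x ≠ 0) :
    ∃ L : ℝ × ℝ → ℂ, Continuous L ∧ ∀ x, Complex.exp (L x) = F x := by
  obtain ⟨L, ⟨-, hL⟩, -⟩ := Complex.isCoveringMapOn_exp.existsUnique_continuousMap_lifts
    ⟨F, hF⟩ (a₀ := 0) (e₀ := Complex.log (F 0)) (Complex.exp_log (h0 0)) h0
  exact ⟨L, L.continuous, fun x => congrFun hL x⟩

/-- Along a continuous choice of argument, a curve in the right half plane that starts on the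
positive and ends on the negative imaginary axis turns by `-π`. -/
theorem Real.sub_eq_neg_pi_of_cos_nonneg {θ : ℝ → ℝ} (hθ : Continuous θ)
    (hcos : ∀ t, 0 ≤ Real.cos (θ t)) (h0 : Real.cos (θ 0) = 0) (h0' : 0 < Real.sin (θ 0))
    (h1 : Real.cos (θ 1) = 0) (h1' : Real.sin (θ 1) < 0) : θ 1 - θ 0 = -Real.pi := by
  have e0 : Real.sin (θ 0) = 1 := by nlinarith [Real.sin_sq_add_cos_sq (θ 0)]
  have e1 : Real.sin (θ 1) = -1 := by nlinarith [Real.sin_sq_add_cos_sq (θ 1)]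
  refine Real.eq_neg_pi_of_continuous_of_sin_nonpos (ψ := fun t => θ t - θ 0) (by fun_prop)
    (sub_self _) (fun t => ?_) ?_
  -- Since `θ 0` is `π / 2` modulo `2π`, `sin (θ t - θ 0) = -cos (θ t)`.
  · have := hcos t
    simp only [Real.sin_sub, h0, e0]
    linarith
  · simp only [Real.cos_sub, h0, e0, h1, e1]
    norm_num

/-- Two curves in a vertical strip from its left to its right side, whose starting points and end
points are in opposite vertical orders, intersect. -/
theorem exists_eq_of_continuous_of_mem_strip {a b : ℝ} {f g : ℝ → ℝ × ℝ} (hf : Continuous f)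
    (hg : Continuous g) (hfs : ∀ t, (f t).1 ∈ Set.Icc a b) (hgs : ∀ t, (g t).1 ∈ Set.Icc a b)
    (hf0 : (f 0).1 = a) (hg0 : (g 0).1 = a) (hf1 : (f 1).1 = b) (hg1 : (g 1).1 = b)
    (h0 : (g 0).2 < (f 0).2) (h1 : (f 1).2 < (g 1).2) : ∃ s t, f s = g t := by
  by_contra! hne
  -- `f s - g t` never vanishes, so it has a logarithm `L` continuous on the whole plane; `L.im` is
  -- its argument.
  have hF : Continuous fun x : ℝ × ℝ =>
      (⟨(f x.1).1 - (g x.2).1, (f x.1).2 - (g x.2).2⟩ : ℂ) := by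
    have : Continuous fun x : ℝ × ℝ => Complex.equivRealProdCLM.symm (f x.1 - g x.2) := by fun_prop
    exact this
  obtain ⟨L, hL, hexp⟩ := Complex.exists_continuous_exp_eq hF fun x h => hne x.1 x.2 <| by
    simp only [Complex.ext_iff, Complex.zero_re, Complex.zero_im, sub_eq_zero] at h
    exact Prod.ext h.1 h.2
  have hre (s t : ℝ) : Real.exp (L (s, t)).re * Real.cos (L (s, t)).im = (f s).1 - (g t).1 := by
    rw [← Complex.exp_re, hexp]
  have him (s t : ℝ) : Real.exp (L (s, t)).re * Real.sin (L (s, t)).im = (f s).2 - (g t).2 := by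
    rw [← Complex.exp_im, hexp]
  have hcos0 : Real.cos (L (0, 0)).im = 0 := by
    have := hre 0 0
    rwa [hf0, hg0, sub_self, mul_eq_zero, or_iff_right (Real.exp_pos _).ne'] at this
  have hcos1 : Real.cos (L (1, 1)).im = 0 := by
    have := hre 1 1
    rwa [hf1, hg1, sub_self, mul_eq_zero, or_iff_right (Real.exp_pos _).ne'] at this
  have hsin0 : 0 < Real.sin (L (0, 0)).im :=
    pos_of_mul_pos_right ((him 0 0).symm ▸ sub_pos.2 h0) (Real.exp_pos _).le
  have hsin1 : Real.sin (L (1, 1)).im < 0 :=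
    neg_of_mul_neg_right ((him 1 1).symm ▸ sub_neg.2 h1) (Real.exp_pos _).le
  -- Go from `(0, 0)` to `(1, 1)` via `(1, 0)`: either `g` is at the left side or `f` at the right,
  -- so the difference points right and turns by `-π`.
  have hright := Real.sub_eq_neg_pi_of_cos_nonneg
    (θ := fun r => (L (min (2 * r) 1, max (2 * r - 1) 0)).im) (by fun_prop)
    (fun r => by
      refine nonneg_of_mul_nonneg_right ?_ (Real.exp_pos (L (min (2 * r) 1, max (2 * r - 1) 0)).re)
      rw [hre, sub_nonneg]
      rcases le_total (2 * r) 1 with hr | hr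
      · rw [max_eq_right (by linarith), hg0]
        exact (hfs _).1
      · rw [min_eq_right hr, hf1]
        exact (hgs _).2)
    (by norm_num [hcos0]) (by norm_num [hsin0]) (by norm_num [hcos1]) (by norm_num [hsin1])
  -- Via `(0, 1)` the difference points left. Reflection `θ ↦ π - θ` gives a turn of `+π` between
  -- the same endpoints, a contradiction.
  have hleft := Real.sub_eq_neg_pi_of_cos_nonneg
    (θ := fun r => Real.pi - (L (max (2 * r - 1) 0, min (2 * r) 1)).im) (by fun_prop)
    (fun r => by
      rw [Real.cos_pi_sub, neg_nonneg]
      refine nonpos_of_mul_nonpos_right ?_ (Real.exp_pos (L (max (2 * r - 1) 0, min (2 * r) 1)).re)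
      rw [hre, sub_nonpos]
      rcases le_total (2 * r) 1 with hr | hr
      · rw [max_eq_right (by linarith), hf0]
        exact (hgs _).1
      · rw [min_eq_right hr, hg1]
        exact (hfs _).2)
    (by norm_num [hcos0]) (by norm_num [hsin0]) (by norm_num [hcos1]) (by norm_num [hsin1])
  norm_num at hright hleft
  linarith [Real.pi_pos]

/-! ### Paths as curves in the drawing -/

namespace PlaneDrawing

variable {V : Type*} [Quiver V]

/-- The points of the drawing that lie on a vertex of a path or on an edge between two vertices of
the path. -/
def trace (D : PlaneDrawing V) (l : List V) : Set (ℝ × ℝ) :=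
  {x | (∃ w ∈ l, x = D.pos w) ∨ ∃ e u, e.left ∈ l ∧ e.right ∈ l ∧ x = D.arc e u}

theorem trace_mono (D : PlaneDrawing V) {l l' : List V} (h : l ⊆ l') : D.trace l ⊆ D.trace l' := by
  rintro x (⟨w, hw, rfl⟩ | ⟨e, u, h1, h2, rfl⟩)
  · exact Or.inl ⟨w, h hw, rfl⟩
  · exact Or.inr ⟨e, u, h h1, h h2, rfl⟩

theorem exists_path_mem_trace (D : PlaneDrawing V) {a b : V} (p : Quiver.Path a b) :
    ∃ γ : _root_.Path (D.pos a) (D.pos b), ∀ t, γ t ∈ D.trace p.vertices := by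
  induction p with
  | nil => exact ⟨.refl _, fun t => Or.inl ⟨a, by simp, rfl⟩⟩
  | @cons b c p e ih =>
    obtain ⟨γ, hγ⟩ := ih
    refine ⟨γ.trans (D.arc ⟨b, c, e⟩), fun t => ?_⟩
    rcases (_root_.Path.trans_range γ (D.arc ⟨b, c, e⟩)).subset (Set.mem_range_self t) with
      ⟨u, hu⟩ | ⟨u, hu⟩
    · rw [← hu]
      exact D.trace_mono (by simp) (hγ u)
    · exact Or.inr ⟨⟨b, c, e⟩, u, by simp, by simp, hu.symm⟩

/-- A trace may contain edges off the path, which is harmless: distinct arcs meet only at a vertex,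
which is an end of both and so lies in both lists. -/
theorem not_disjoint_of_mem_trace (D : PlaneDrawing V) {l l' : List V} {x : ℝ × ℝ}
    (h : x ∈ D.trace l) (h' : x ∈ D.trace l') : ¬ l.Disjoint l' := by
  have of_arc {l : List V} {e u w} (h1 : e.left ∈ l) (h2 : e.right ∈ l)
      (hu : D.arc e u = D.pos w) : w ∈ l := by
    rcases D.arc_vertex e u w hu with rfl | rfl <;> assumption
  intro hd
  rcases h with ⟨w, hw, rfl⟩ | ⟨e, u, h1, h2, rfl⟩ <;>
    rcases h' with ⟨w', hw', hx⟩ | ⟨e', u', h1', h2', hx⟩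
  · exact hd hw (D.pos_injective hx ▸ hw')
  · exact hd hw (of_arc h1' h2' hx.symm)
  · exact hd (of_arc h1 h2 hx) hw'
  · by_cases hee : e = e'
    · exact hd h1 (hee ▸ h1')
    · obtain ⟨w, hw⟩ := D.arc_inter e e' u u' hee hx
      exact hd (of_arc h1 h2 hw) (of_arc h1' h2' (hx ▸ hw))

end PlaneDrawing

namespace PlanarNetwork

variable {V : Type*} [Quiver V] {n : ℕ}

theorem trace_mem_strip (G : PlanarNetwork V n) {l : List V} {x : ℝ × ℝ}
    (h : x ∈ G.drawing.trace l) : x.1 ∈ Set.Icc G.xleft G.xright := by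
  rcases h with ⟨w, -, rfl⟩ | ⟨e, u, -, -, rfl⟩
  · exact G.pos_mem_strip w
  · exact G.arc_mem_strip e u

theorem lt_of_disjoint (G : PlanarNetwork V n) {i i' j j' : Fin n} (hi : i < i')
    (p : Quiver.Path (G.source i) (G.sink j)) (p' : Quiver.Path (G.source i') (G.sink j'))
    (hd : p.vertices.Disjoint p'.vertices) : j < j' := by
  by_contra! hj
  rcases hj.lt_or_eq with hj | rfl
  · obtain ⟨γ, hγ⟩ := G.drawing.exists_path_mem_trace p
    obtain ⟨γ', hγ'⟩ := G.drawing.exists_path_mem_trace p'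
    have hγ (t : ℝ) : γ.extend t ∈ G.drawing.trace p.vertices := hγ _
    have hγ' (t : ℝ) : γ'.extend t ∈ G.drawing.trace p'.vertices := hγ' _
    obtain ⟨s, t, hst⟩ := exists_eq_of_continuous_of_mem_strip γ.continuous_extend
      γ'.continuous_extend (fun t => G.trace_mem_strip (hγ t)) (fun t => G.trace_mem_strip (hγ' t))
      (by simp [G.source_left]) (by simp [G.source_left]) (by simp [G.sink_right])
      (by simp [G.sink_right]) (by simpa using G.source_top_to_bottom hi)
      (by simpa using G.sink_top_to_bottom hj)
    exact G.drawing.not_disjoint_of_mem_trace (hγ s) (hst ▸ hγ' t) hd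
  · exact hd p.end_mem_vertices p'.end_mem_vertices

theorem DisjointFamily.strictMono (G : PlanarNetwork V n) {I J : Finset (Fin n)}
    (F : G.DisjointFamily I J) : StrictMono F.matching := fun i i' h =>
  G.lt_of_disjoint h (F.path i) (F.path i') (F.disjoint i i' h.ne)

end PlanarNetwork

/-! ### Paths in acyclic quivers -/

namespace Quiver.Path

variable {V : Type*} [Quiver V]

/-- The list of arrows of a path. -/
def arrows {a : V} : ∀ {b : V}, Path a b → List (Total V)
  | _, nil => []
  | _, cons p e => p.arrows ++ [⟨_, _, e⟩]

theorem length_arrows {a b : V} (p : Path a b) : p.arrows.length = p.length := by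
  induction p with
  | nil => rfl
  | cons p e ih => simp [arrows, ih]

theorem arrows_comp {a b c : V} (p : Path a b) (q : Path b c) :
    (p.comp q).arrows = p.arrows ++ q.arrows := by
  induction q with
  | nil => simp [arrows]
  | cons q e ih => simp [arrows, ih]

theorem arrows_cast {a b a' b' : V} (ha : a = a') (hb : b = b') (p : Path a b) :
    (p.cast ha hb).arrows = p.arrows := by
  subst ha hb; rfl

theorem vertices_cast {a b a' b' : V} (ha : a = a') (hb : b = b') (p : Path a b) :
    (p.cast ha hb).vertices = p.vertices := by
  subst ha hb; rfl

/-- Arrow lists have a type free of endpoints, so paths can be compared without transport. -/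
theorem arrows_injective (a b : V) : Function.Injective (arrows : Path a b → List (Total V)) := by
  intro p q h
  induction p with
  | nil =>
    cases q with
    | nil => rfl
    | cons q e => simp [arrows] at h
  | cons p e ih =>
    cases q with
    | nil => simp [arrows] at h
    | cons q e' =>
      obtain ⟨h1, h2⟩ := List.append_inj' h rfl
      simp only [List.cons.injEq, Total.mk.injEq, true_and, and_true] at h2
      obtain ⟨rfl, h2⟩ := h2
      rw [ih h1, eq_of_heq h2]

theorem nodup_vertices (hac : ∀ (v : V) (p : Path v v), p = nil) {a b : V} (p : Path a b) :
    p.vertices.Nodup := by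
  induction p with
  | nil => simp
  | @cons b c p e ih =>
    rw [vertices_cons, List.nodup_concat]
    refine ⟨fun hc => ?_, ih⟩
    obtain ⟨-, q, -⟩ := p.exists_eq_comp_of_mem_vertices hc
    exact cons_ne_nil q e (hac c (q.cons e))

/-- No vertex repeats, so a path has fewer than `Fintype.card V` arrows. -/
theorem finite_of_acyclic [Finite V] [∀ a b : V, Finite (a ⟶ b)]
    (hac : ∀ (v : V) (p : Path v v), p = nil) (a b : V) : Finite (Path a b) := by
  have : Finite (Total V) :=
    Finite.of_injective (fun e => (⟨e.left, e.right, e.hom⟩ : Σ a b : V, (a ⟶ b))) <| by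
      rintro ⟨l, r, e⟩ ⟨l', r', e'⟩ h
      cases h
      rfl
  have := Fintype.ofFinite V
  have hfin := (List.finite_length_lt (Total V) (Fintype.card V)).to_subtype
  refine Finite.of_injective (fun p : Path a b =>
    (⟨p.arrows, ?_⟩ : {l : List (Total V) | l.length < Fintype.card V})) ?_
  · have := (p.nodup_vertices hac).length_le_card
    rw [vertices_length] at this
    simpa [length_arrows] using this
  · exact fun p q h => arrows_injective a b (Subtype.ext_iff.1 h)

/-- Without cycles a path visits a vertex only once, so the cut there is unique. This identifies the
chosen `head` and `tail` after an exchange. -/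
theorem arrows_eq_of_comp_eq_comp (hac : ∀ (v : V) (p : Path v v), p = nil) {a b v v' : V}
    (hv : v = v') {h : Path a v} {t : Path v b} {h' : Path a v'} {t' : Path v' b}
    (heq : h.comp t = h'.comp t') : h.arrows = h'.arrows ∧ t.arrows = t'.arrows := by
  subst hv
  induction t with
  | nil =>
    obtain rfl := hac _ t'
    simp_all
  | cons t e ih =>
    cases t' with
    | nil => exact absurd (hac _ (t.cons e)) (cons_ne_nil t e)
    | cons t' e' =>
      simp only [comp_cons, cons.injEq] at heq
      obtain ⟨rfl, h1, h2⟩ := heq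
      obtain ⟨i1, i2⟩ := ih (eq_of_heq h1)
      exact ⟨i1, by simp [arrows, i2, eq_of_heq h2]⟩

/-! ### Path families and exchange of tails -/

variable {ι : Type*} (a b : ι → V)

/-- The families of paths that join the vertices `a i` to the vertices `b i` in some order. -/
abbrev Family : Type _ := Σ σ : Equiv.Perm ι, ∀ i, Path (a i) (b (σ i))

namespace Family

variable {a b}

/-- The paths of the family are pairwise vertex-disjoint. -/
def IsDisjoint (x : Family a b) : Prop :=
  Pairwise fun i j => List.Disjoint (x.2 i).vertices (x.2 j).vertices

theorem ext_of_arrows {x y : Family a b} (h1 : x.1 = y.1)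
    (h2 : ∀ i, (x.2 i).arrows = (y.2 i).arrows) : x = y := by
  obtain ⟨σ, p⟩ := x
  obtain ⟨σ', q⟩ := y
  obtain rfl : σ = σ' := h1
  congr
  exact funext fun i => arrows_injective _ _ (h2 i)

open Classical in
/-- The vertex at which the `i`-th path of the family is cut: `v` if the path visits `v`. -/
noncomputable def cut (x : Family a b) (v : V) (i : ι) : V :=
  -- A path that misses `v` is cut at its start, so that heads and tails exist for all `i`.
  if v ∈ (x.2 i).vertices then v else a i

theorem cut_of_mem {x : Family a b} {v : V} {i : ι} (h : v ∈ (x.2 i).vertices) :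
    x.cut v i = v := if_pos h

theorem cut_mem (x : Family a b) (v : V) (i : ι) : x.cut v i ∈ (x.2 i).vertices := by
  unfold cut
  split_ifs with h
  exacts [h, start_mem_vertices _]

/-- The part of the `i`-th path before the cut. -/
noncomputable def head (x : Family a b) (v : V) (i : ι) : Path (a i) (x.cut v i) :=
  (exists_eq_comp_of_mem_vertices _ (x.cut_mem v i)).choose

/-- The part of the `i`-th path after the cut. -/
noncomputable def tail (x : Family a b) (v : V) (i : ι) : Path (x.cut v i) (b (x.1 i)) :=
  (exists_eq_comp_of_mem_vertices _ (x.cut_mem v i)).choose_spec.choose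

theorem head_comp_tail (x : Family a b) (v : V) (i : ι) : (x.head v i).comp (x.tail v i) = x.2 i :=
  (exists_eq_comp_of_mem_vertices _ (x.cut_mem v i)).choose_spec.choose_spec.symm

/-- The family obtained by a permutation of the parts of the paths after the cuts. -/
noncomputable def permTails (x : Family a b) (v : V) (τ : Equiv.Perm ι)
    (hτ : ∀ i, x.cut v (τ i) = x.cut v i) : Family a b :=
  ⟨x.1 * τ, fun i => (x.head v i).comp ((x.tail v (τ i)).cast (hτ i) rfl)⟩

theorem arrows_permTails (x : Family a b) (v : V) (τ : Equiv.Perm ι)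
    (hτ : ∀ i, x.cut v (τ i) = x.cut v i) (i : ι) : ((x.permTails v τ hτ).2 i).arrows =
      (x.head v i).arrows ++ (x.tail v (τ i)).arrows :=
  (arrows_comp _ _).trans (congrArg _ (arrows_cast (hτ i) rfl _))

theorem vertices_snd_permTails (x : Family a b) (v : V) (τ : Equiv.Perm ι)
    (hτ : ∀ i, x.cut v (τ i) = x.cut v i) (i : ι) : ((x.permTails v τ hτ).2 i).vertices =
      (x.head v i).vertices.dropLast ++ (x.tail v (τ i)).vertices :=
  (vertices_comp _ _).trans (congrArg _ (vertices_cast (hτ i) rfl _))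

/-- A moved tail starts at `v`. The set of paths through `v` is thus preserved, and the involution
finds the same transposition again. -/
theorem mem_vertices_permTails (x : Family a b) (v : V) (τ : Equiv.Perm ι)
    (hτ : ∀ i, x.cut v (τ i) = x.cut v i) (hv : ∀ i, τ i ≠ i → v ∈ (x.2 i).vertices) (i : ι) :
    v ∈ ((x.permTails v τ hτ).2 i).vertices ↔ v ∈ (x.2 i).vertices := by
  by_cases hi : τ i = i
  · rw [vertices_snd_permTails, ← x.head_comp_tail v i, vertices_comp, hi]
  · refine iff_of_true ?_ (hv i hi)
    have hcut : x.cut v (τ i) = v := (hτ i).trans (cut_of_mem (hv i hi))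
    rw [vertices_snd_permTails]
    exact List.mem_append_right _ ((congrArg (· ∈ _) hcut).mp (x.tail v (τ i)).start_mem_vertices)

open Classical in
theorem cut_permTails (x : Family a b) (v : V) (τ : Equiv.Perm ι)
    (hτ : ∀ i, x.cut v (τ i) = x.cut v i) (hv : ∀ i, τ i ≠ i → v ∈ (x.2 i).vertices) (i : ι) :
    (x.permTails v τ hτ).cut v i = x.cut v i :=
  if_congr (x.mem_vertices_permTails v τ hτ hv i) rfl rfl

theorem permTails_permTails (hac : ∀ (v : V) (p : Path v v), p = nil) (x : Family a b) (v : V)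
    (τ : Equiv.Perm ι) (hτ : ∀ i, x.cut v (τ i) = x.cut v i)
    (hv : ∀ i, τ i ≠ i → v ∈ (x.2 i).vertices) (hττ : ∀ i, τ (τ i) = i)
    (hτ' : ∀ i, (x.permTails v τ hτ).cut v (τ i) = (x.permTails v τ hτ).cut v i) :
    (x.permTails v τ hτ).permTails v τ hτ' = x := by
  have key (i : ι) : ((x.permTails v τ hτ).head v i).arrows = (x.head v i).arrows ∧
      ((x.permTails v τ hτ).tail v i).arrows = (x.tail v (τ i)).arrows := by
    obtain ⟨h1, h2⟩ := arrows_eq_of_comp_eq_comp hac (x.cut_permTails v τ hτ hv i)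
      ((x.permTails v τ hτ).head_comp_tail v i)
    exact ⟨h1, h2.trans (arrows_cast (hτ i) rfl _)⟩
  refine ext_of_arrows (Equiv.ext fun i => congrArg x.1 (hττ i)) fun i => ?_
  rw [arrows_permTails, (key i).1, (key (τ i)).2, hττ, ← x.head_comp_tail v i, arrows_comp]

theorem not_isDisjoint_iff (x : Family a b) : ¬ x.IsDisjoint ↔
    ∃ v i j, i ≠ j ∧ v ∈ (x.2 i).vertices ∧ v ∈ (x.2 j).vertices := by
  simp only [IsDisjoint, Pairwise, List.Disjoint]
  push Not
  grind

variable [Fintype ι]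

/-- All vertices of the paths of a family, with multiplicity. -/
def vertices (x : Family a b) : Multiset V := ∑ i, ((x.2 i).vertices : Multiset V)

/-- The cut vertex will be chosen from this multiset alone; its invariance makes the choice survive
the exchange. -/
theorem vertices_permTails (x : Family a b) (v : V) (τ : Equiv.Perm ι)
    (hτ : ∀ i, x.cut v (τ i) = x.cut v i) : (x.permTails v τ hτ).vertices = x.vertices := by
  have h1 : x.vertices = ∑ i, (((x.head v i).vertices.dropLast : Multiset V) +
      ((x.tail v i).vertices : Multiset V)) :=
    Finset.sum_congr rfl fun i _ => by rw [← x.head_comp_tail v i, vertices_comp]; simp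
  have h2 : (x.permTails v τ hτ).vertices =
      ∑ i, (((x.head v i).vertices.dropLast : Multiset V) +
        ((x.tail v (τ i)).vertices : Multiset V)) :=
    Finset.sum_congr rfl fun i _ => by simp [vertices_snd_permTails]
  rw [h1, h2, Finset.sum_add_distrib, Finset.sum_add_distrib,
    Equiv.sum_comp τ fun i => ((x.tail v i).vertices : Multiset V)]

open Classical in
theorem exists_mem_mem_iff (hac : ∀ (v : V) (p : Path v v), p = nil) (x : Family a b) (v : V) :
    (∃ i j, i ≠ j ∧ v ∈ (x.2 i).vertices ∧ v ∈ (x.2 j).vertices) ↔ 1 < x.vertices.count v := by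
  have h : x.vertices.count v = (Finset.univ.filter fun i => v ∈ (x.2 i).vertices).card := by
    rw [vertices, Multiset.count_sum', Finset.card_filter]
    exact Finset.sum_congr rfl fun i _ => by
      rw [Multiset.coe_count, List.Nodup.count (nodup_vertices hac _)]
  rw [h, Finset.one_lt_card_iff]
  simp only [Finset.mem_filter, Finset.mem_univ, true_and]
  exact ⟨fun ⟨i, j, h1, h2, h3⟩ => ⟨i, j, h2, h3, h1⟩, fun ⟨i, j, h2, h3, h1⟩ => ⟨i, j, h1, h2, h3⟩⟩

open Classical in
/-- The involution that exchanges the parts after a common vertex of two paths in a family. -/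
theorem exists_sign_reversing_involution (hac : ∀ (v : V) (p : Path v v), p = nil) :
    ∃ f : ∀ x : Family a b, ¬ x.IsDisjoint → Family a b, ∀ x hx, ∃ hx' : ¬ (f x hx).IsDisjoint,
      f (f x hx) hx' = x ∧ Equiv.Perm.sign (f x hx).1 = -Equiv.Perm.sign x.1 := by
  have hcount (x : Family a b) (hx : ¬ x.IsDisjoint) : ∃ v, 1 < x.vertices.count v := by
    obtain ⟨v, h⟩ := x.not_isDisjoint_iff.1 hx
    exact ⟨v, (x.exists_mem_mem_iff hac v).1 h⟩
  have hswap (S : Set ι) (h : ∃ i j, i ≠ j ∧ i ∈ S ∧ j ∈ S) : ∃ τ : Equiv.Perm ι,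
      Equiv.Perm.sign τ = -1 ∧ (∀ i, τ (τ i) = i) ∧ ∀ i, τ i ≠ i → i ∈ S := by
    obtain ⟨i, j, hij, hi, hj⟩ := h
    refine ⟨Equiv.swap i j, Equiv.Perm.sign_swap hij, Equiv.swap_apply_self i j, fun k hk => ?_⟩
    rcases (Equiv.swap_apply_ne_self_iff.1 hk).2 with rfl | rfl <;> assumption
  -- The choices depend only on a multiset of vertices and a set of indices, not on the family, so
  -- they agree for `x` and its image.
  choose φ hφ using fun (m : Multiset V) (h : ∃ v, 1 < m.count v) => h
  choose τ hsign hττ hτS using hswap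
  let c (x : Family a b) (hx : ¬ x.IsDisjoint) : V := φ x.vertices (hcount x hx)
  have hS (x : Family a b) (hx : ¬ x.IsDisjoint) :
      ∃ i j, i ≠ j ∧ i ∈ {i | c x hx ∈ (x.2 i).vertices} ∧ j ∈ {i | c x hx ∈ (x.2 i).vertices} :=
    (x.exists_mem_mem_iff hac _).2 (hφ _ _)
  have hcut (x : Family a b) (hx : ¬ x.IsDisjoint) (i : ι) :
      x.cut (c x hx) (τ _ (hS x hx) i) = x.cut (c x hx) i := by
    by_cases hi : τ _ (hS x hx) i = i
    · rw [hi]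
    · rw [cut_of_mem (hτS _ (hS x hx) i hi),
        cut_of_mem (hτS _ (hS x hx) _ fun h => hi ((τ _ (hS x hx)).injective h))]
  refine ⟨fun x hx => x.permTails (c x hx) (τ _ (hS x hx)) (hcut x hx), fun x hx => ?_⟩
  have hvert := x.vertices_permTails (c x hx) (τ _ (hS x hx)) (hcut x hx)
  have hx' : ¬ (x.permTails (c x hx) (τ _ (hS x hx)) (hcut x hx)).IsDisjoint := by
    refine (not_isDisjoint_iff _).2 ⟨c x hx, (exists_mem_mem_iff hac _ _).2 ?_⟩
    rw [hvert]
    exact hφ _ _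
  have hc : c _ hx' = c x hx := by
    simp only [c, hvert]
  have hτ : τ _ (hS _ hx') = τ _ (hS x hx) := by
    congr 1
    ext i
    simp only [Set.mem_ofPred_eq, hc]
    exact x.mem_vertices_permTails _ _ (hcut x hx) (hτS _ (hS x hx)) i
  refine ⟨hx', ?_, ?_⟩
  -- `h'` depends on `v` and `τ'`, so both are generalized before substitution.
  · have aux (v τ' h') (hv : v = c x hx) (hτ' : τ' = τ _ (hS x hx)) :
        (x.permTails (c x hx) (τ _ (hS x hx)) (hcut x hx)).permTails v τ' h' = x := by
      subst hv hτ'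
      exact x.permTails_permTails hac _ _ (hcut x hx) (hτS _ (hS x hx)) (hττ _ (hS x hx)) h'
    exact aux _ _ _ hc hτ
  · simp [permTails, hsign]

open Classical in
/-- The Lindström–Gessel–Viennot lemma. -/
theorem det_card_eq_sum_sign (hac : ∀ (v : V) (p : Path v v), p = nil)
    [∀ u v : V, Finite (Path u v)] [Fintype (Family a b)] {R : Type*} [CommRing R] :
    (Matrix.of fun i j => (Nat.card (Path (a i) (b j)) : R)).det =
      ∑ x : Family a b with x.IsDisjoint, ((Equiv.Perm.sign x.1 : ℤ) : R) := by
  have := fun u v : V => Fintype.ofFinite (Path u v)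
  have h1 : (Matrix.of fun i j => (Nat.card (Path (a i) (b j)) : R)).det =
      ∑ x : Family a b, ((Equiv.Perm.sign x.1 : ℤ) : R) := by
    -- After transposition the product for `σ` runs over the entries `(i, σ i)`, hence counts the
    -- families with permutation `σ`.
    rw [← Matrix.det_transpose, Matrix.det_apply']
    trans ∑ σ : Equiv.Perm ι, ∑ p : ∀ i, Path (a i) (b (σ i)), ((Equiv.Perm.sign σ : ℤ) : R)
    · refine Finset.sum_congr rfl fun σ _ => ?_
      simp [Nat.card_eq_fintype_card, mul_comm]
    · convert (Fintype.sum_sigma fun x : Family a b => ((Equiv.Perm.sign x.1 : ℤ) : R)).symm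
  obtain ⟨f, hf⟩ := exists_sign_reversing_involution (a := a) (b := b) hac
  have h2 : ∑ x : Family a b with ¬ x.IsDisjoint, ((Equiv.Perm.sign x.1 : ℤ) : R) = 0 := by
    refine Finset.sum_involution (fun x hx => f x (Finset.mem_filter.1 hx).2) ?_ ?_ ?_ ?_
    · intro x hx
      rw [(hf x (Finset.mem_filter.1 hx).2).choose_spec.2]
      simp
    -- Signs are compared in `ℤˣ`, since `1 = -1` is possible in `R`.
    · intro x hx _ h
      have := (hf x (Finset.mem_filter.1 hx).2).choose_spec.2
      rw [h] at this
      exact units_ne_neg_self _ this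
    · exact fun x hx => Finset.mem_filter.2
        ⟨Finset.mem_univ _, (hf x (Finset.mem_filter.1 hx).2).choose⟩
    · exact fun x hx => (hf x (Finset.mem_filter.1 hx).2).choose_spec.1
  rw [h1, ← Finset.sum_filter_add_sum_filter_not _ fun x : Family a b => x.IsDisjoint, h2, add_zero]

end Family

/-- The Lindström–Gessel–Viennot lemma for sources and sinks that can be joined by disjoint paths
in one order only. -/
theorem det_card_eq_card_disjoint [DecidableEq ι] [Fintype ι] {a b : ι → V}
    (hac : ∀ (v : V) (p : Path v v), p = nil)
    [∀ u v : V, Finite (Path u v)] (h : ∀ x : Family a b, x.IsDisjoint → x.1 = 1)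
    {R : Type*} [CommRing R] :
    (Matrix.of fun i j => (Nat.card (Path (a i) (b j)) : R)).det =
      Nat.card {p : ∀ i, Path (a i) (b i) //
        Pairwise fun i j => List.Disjoint (p i).vertices (p j).vertices} := by
  classical
  have := Fintype.ofFinite (Family a b)
  have e : {p : ∀ i, Path (a i) (b i) //
      Pairwise fun i j => List.Disjoint (p i).vertices (p j).vertices} ≃
      {x : Family a b // x.IsDisjoint} := by
    refine Equiv.ofBijective (fun p => ⟨⟨1, p.1⟩, p.2⟩) ⟨fun p q hpq => ?_, fun x => ?_⟩
    · exact Subtype.ext (eq_of_heq (Sigma.mk.inj (Subtype.ext_iff.1 hpq)).2)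
    · obtain ⟨⟨σ, p⟩, hx⟩ := x
      obtain rfl : σ = 1 := h _ hx
      exact ⟨⟨p, hx⟩, rfl⟩
  have hdet := Family.det_card_eq_sum_sign (a := a) (b := b) (R := R) hac
  rw [Nat.card_congr e, Nat.card_eq_fintype_card, Fintype.card_subtype, ← nsmul_one,
    ← Finset.sum_const]
  convert hdet.trans (Finset.sum_congr rfl fun x hx => ?_)
  simp [h x (Finset.mem_filter.1 hx).2]

end Quiver.Path

/-! ### Minors of the path matrix -/

namespace PlanarNetwork

variable {V : Type*} [Quiver V] {n : ℕ}

theorem finite_path (G : PlanarNetwork V n) (u v : V) : Finite (Quiver.Path u v) :=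
  have := G.finite_vertices
  have := G.finite_edges
  Quiver.Path.finite_of_acyclic G.acyclic u v

theorem finite_disjointFamily (G : PlanarNetwork V n) (I J : Finset (Fin n)) :
    Finite (G.DisjointFamily I J) := by
  have := G.finite_path
  refine Finite.of_injective (fun F => (⟨F.matching, F.path⟩ :
    Σ m : I ≃ J, ∀ i : I, Quiver.Path (G.source i) (G.sink (m i)))) fun F F' h => ?_
  cases F
  cases F'
  cases h
  rfl

/-- The order preserving bijection between two sets of indices of the same size. -/
noncomputable def indexIso (I J : Finset (Fin n)) (h : I.card = J.card) : I ≃o J :=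
  (I.orderIsoOfFin h).symm.trans (J.orderIsoOfFin rfl)

theorem eq_indexIso {I J : Finset (Fin n)} (h : I.card = J.card) {m : I ≃ J} (hm : StrictMono m) :
    m = (indexIso I J h).toEquiv := by
  let e : I ≃o J := StrictMono.orderIsoOfSurjective m hm m.surjective
  have he : e = indexIso I J h := Subsingleton.elim _ _
  rw [← he]
  exact Equiv.ext fun _ => rfl

theorem card_disjointFamily (G : PlanarNetwork V n) (I J : Finset (Fin n)) (h : I.card = J.card) :
    Nat.card {p : ∀ i : I, Quiver.Path (G.source i) (G.sink (indexIso I J h i)) //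
        Pairwise fun i j => List.Disjoint (p i).vertices (p j).vertices} =
      Nat.card (G.DisjointFamily I J) := by
  refine Nat.card_eq_of_bijective
    (fun p => ⟨(indexIso I J h).toEquiv, p.1, fun i j hij => p.2 hij⟩) ⟨fun p q hpq => ?_,
      fun F => ?_⟩
  · injection hpq with _ hpq
    exact Subtype.ext hpq
  · have hF := eq_indexIso h (DisjointFamily.strictMono G F)
    obtain ⟨m, p, hd⟩ := F
    obtain rfl : m = (indexIso I J h).toEquiv := hF
    exact ⟨⟨p, fun i j hij => hd i j hij⟩, rfl⟩

/-- Columns are indexed by `I` through `indexIso`. A disjoint family with permutation `σ` has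
matching `indexIso ∘ σ`; this is increasing, hence equal to `indexIso`, so `σ = 1`. -/
theorem minorDet_eq_card (G : PlanarNetwork V n) (I J : Finset (Fin n)) (h : I.card = J.card) :
    G.pathMatrix.minorDet I J h = (Nat.card (G.DisjointFamily I J) : ℝ) := by
  have := G.finite_path
  have hdet : G.pathMatrix.minorDet I J h = (Matrix.of fun i i' : I =>
      (Nat.card (Quiver.Path (G.source i) (G.sink (indexIso I J h i'))) : ℝ)).det := by
    rw [← Matrix.det_submatrix_equiv_self (I.orderIsoOfFin h).toEquiv, Matrix.minorDet]
    congr 1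
    ext i j
    simp [pathMatrix, indexIso]
  rw [hdet, ← G.card_disjointFamily I J h]
  refine Quiver.Path.det_card_eq_card_disjoint (a := fun i : I => G.source i)
    (b := fun i : I => G.sink (indexIso I J h i)) G.acyclic fun x hx => ?_
  have hx' := DisjointFamily.strictMono G (I := I) (J := J)
    ⟨x.1.trans (indexIso I J h).toEquiv, x.2, fun i j hij => hx hij⟩
  refine Equiv.ext fun i => (indexIso I J h).injective ?_
  exact congrArg (fun m : I ≃ J => m i) (eq_indexIso h hx')

end PlanarNetwork

theorem mainTheorem1 {V : Type*} [Quiver V] {n : ℕ} (G : PlanarNetwork V n) :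
    (∀ i j : Fin n, Finite (Quiver.Path (G.source i) (G.sink j))) ∧
    G.pathMatrix.IsTotallyNonnegative ∧
    ∀ (I J : Finset (Fin n)) (h : I.card = J.card),
      Finite (G.DisjointFamily I J) ∧
      G.pathMatrix.minorDet I J h = (Nat.card (G.DisjointFamily I J) : ℝ) ∧
      ∀ F : G.DisjointFamily I J, StrictMono F.matching :=
  ⟨fun _ _ => G.finite_path _ _,
    fun I J h => (G.minorDet_eq_card I J h).symm ▸ Nat.cast_nonneg _,
    fun I J h => ⟨G.finite_disjointFamily I J, G.minorDet_eq_card I J h,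
      PlanarNetwork.DisjointFamily.strictMono G⟩⟩
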